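/- **Theorem (Bayesian law of large numbers).** Let $\mathcal P$ be the set of Borel probability measures on $\mathbb R$ dominated by Lebesgue measure, with the weak topology and its Borel $\sigma$-field; densities are denoted by the same letters as measures. Let $X_1,X_2,\dots$ be i.i.d. with density $r\in\mathcal P$, let $\Pi$ be a prior probability measure on $\mathcal P$, and let $\Phi\subseteq\mathcal P$; it is not assumed that $r\in\Phi$. For $q,p\in\mathcal P$ let $L(q\|p)=-\int p\log q$ (with $\log 0=-\infty$, and the value $+\infty$ if the integral is undefined), and for $Q\subseteq\mathcal P$ let $L(Q\|p)=\inf_{q\in Q}L(q\|p)$. An *$L$-projection* of $p$ on $Q$ is a $\hat q\in Q$ with $L(\hat q\|p)=L(Q\|p)$. For $\delta>0$ let $B_\delta(q,p)=\{q'\in\mathcal P: L(q'\|p)<L(q\|p)+\delta\}$. Fix versions $q(x)$ of the densities that are jointly measurable in $(q,x)\in\mathcal P\times\mathbb R$ (such versions exist, and any choice is allowed), and for measurable $Q\subseteq\mathcal P$ let $$\Pi_n(Q\mid X_1^n)=\frac{\int_{Q\cap\Phi}\prod_{i=1}^n q(X_i)\,\Pi(dq)}{\int_{\Phi}\prod_{i=1}^n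 q(X_i)\,\Pi(dq)} .$$ Suppose that $\Phi$ is open in the weak topology, that 1. $\Pi(B_\delta(q,r))>0$ for every $q\in\Phi$ and every $\delta>0$, and 2. $L(\Phi\|r)<\infty$, where also $L(\Phi\|r)>-\infty$. Let $1\le\kappa<\infty$, let $\hat q_1,\dots,\hat q_\kappa$ be $L$-projections of $r$ on $\Phi$, let $\varepsilon>0$, and let $U=\bigcup_{k=1}^\kappa W(\hat q_k,\varepsilon)$, where $W(q,\varepsilon)$ is the open ball with center $q$ and radius $\varepsilon$ for a metric on $\mathcal P$ (any metric) that induces the weak topology. Then, almost surely, $$\lim_{n\to\infty}\Pi_n(U\mid X_1^n)=1 .$$ -/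

import Mathlib

open MeasureTheory ProbabilityTheory Filter Topology
open scoped ENNReal

/-- The set of all Borel probability measures on `ℝ` that are dominated by the Lebesgue measure. -/
def DomProb : Type :=
  {q : ProbabilityMeasure ℝ // (q : Measure ℝ) ≪ (volume : Measure ℝ)}

namespace DomProb

/-- The weak topology: the topology of convergence in distribution, restricted to the dominated
probability measures. -/
noncomputable instance weakTopology : TopologicalSpace DomProb :=
  instTopologicalSpaceSubtype
    (p := fun q : ProbabilityMeasure ℝ => (q : Measure ℝ) ≪ (volume : Measure ℝ))

/-- The Borel σ-field of the weak topology. -/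
noncomputable instance borelSigma : MeasurableSpace DomProb := borel DomProb

instance : BorelSpace DomProb := ⟨rfl⟩

/-- The underlying measure on `ℝ`. -/
def toMeasure (q : DomProb) : Measure ℝ := ((q.1 : ProbabilityMeasure ℝ) : Measure ℝ)

instance (q : DomProb) : IsProbabilityMeasure q.toMeasure := q.1.2

/-- The Lebesgue density of `q`, determined up to Lebesgue null sets. -/
noncomputable def pdf (q : DomProb) : ℝ → ℝ≥0∞ := q.toMeasure.rnDeriv volume

/-- The L-divergence `L(q ‖ p) = - ∫ p log q`, as an extended real number: minus the difference of
the integrals of the positive and of the negative part of `log q` with respect to `p`, where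
`log 0 = -∞`. The value is `⊤` also when both integrals are infinite (then the integral is not
defined). -/
noncomputable def Ldiv (q p : DomProb) : EReal :=
  -(((∫⁻ x, (ENNReal.log (q.pdf x)).toENNReal ∂p.toMeasure : ℝ≥0∞) : EReal)
    - ((∫⁻ x, (-ENNReal.log (q.pdf x)).toENNReal ∂p.toMeasure : ℝ≥0∞) : EReal))

/-- The value `L(Q ‖ p)`, the infimum of `L(q ‖ p)` over `q ∈ Q`. It is the value of the
L-divergence at any L-projection of `p` on `Q`, if there is one. -/
noncomputable def LdivSet (Q : Set DomProb) (p : DomProb) : EReal := ⨅ q ∈ Q, Ldiv q p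

/-- `q₀` is an L-projection of `p` on `Q`: a minimizer of `L(· ‖ p)` over `Q`. -/
def IsLProjection (q₀ : DomProb) (Q : Set DomProb) (p : DomProb) : Prop :=
  q₀ ∈ Q ∧ ∀ q ∈ Q, Ldiv q₀ p ≤ Ldiv q p

/-- The ball `B_ε(q, p)` of all dominated `q'` with `L(q' ‖ p) - L(q ‖ p) < ε`. -/
def LBall (ε : ℝ) (q p : DomProb) : Set DomProb := {q' | Ldiv q' p < Ldiv q p + (ε : EReal)}

/-- A choice, for every `q`, of a version `f q` of the Lebesgue density of `q`, such that
`f q x` is jointly measurable in `(q, x)`. -/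
structure IsDensityVersion (f : DomProb → ℝ → ℝ≥0∞) : Prop where
  measurable : Measurable (Function.uncurry f)
  withDensity_eq : ∀ q : DomProb, (volume : Measure ℝ).withDensity (f q) = q.toMeasure

/-- The likelihood `exp (- l_n(q)) = ∏_{i < n} q(x_i)` of the first `n` observations. -/
noncomputable def likelihood (f : DomProb → ℝ → ℝ≥0∞) (x : ℕ → ℝ) (n : ℕ) (q : DomProb) : ℝ≥0∞ :=
  ∏ i ∈ Finset.range n, f q (x i)

/-- The posterior mass of `Q` (more precisely, of the part of `Q` in the model `Φ`) given the
first `n` observations. -/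
noncomputable def posterior (prior : Measure DomProb) (Φ : Set DomProb)
    (f : DomProb → ℝ → ℝ≥0∞) (x : ℕ → ℝ) (n : ℕ) (Q : Set DomProb) : ℝ≥0∞ :=
  (∫⁻ q in Q ∩ Φ, likelihood f x n q ∂prior) / (∫⁻ q in Φ, likelihood f x n q ∂prior)

/-- The metric `d` induces the weak topology. -/
def MetrizesWeak (d : MetricSpace DomProb) : Prop :=
  d.toUniformSpace.toTopologicalSpace = weakTopology

/-- The open ball `W(q, ε)` of the metric `d`. -/
def weakBall (d : MetricSpace DomProb) (q : DomProb) (ε : ℝ) : Set DomProb :=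
  {q' | d.dist q' q < ε}

/-- The evaluations `q ↦ q(s)` are Borel measurable. -/
theorem measurable_toMeasure : Measurable toMeasure := by
  have h : ∀ s, MeasurableSet s → Measurable fun q : DomProb => q.toMeasure s := by
    intro s hs
    induction s, hs using MeasurableSpace.induction_on_inter
      ((BorelSpace.measurable_eq (α := ℝ)).trans rfl) isPiSystem_isOpen with
    | empty => simp
    | basic G hG =>
      refine LowerSemicontinuous.measurable fun q y hy => ?_
      have hc : Tendsto (fun p : DomProb => p.1) (𝓝 q) (𝓝 q.1) :=
        (continuous_subtype_val (p := fun q : ProbabilityMeasure ℝ =>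
          (q : Measure ℝ) ≪ (volume : Measure ℝ))).tendsto q
      have := ProbabilityMeasure.le_liminf_measure_open_of_tendsto hc (show IsOpen G from hG)
      exact eventually_lt_of_lt_liminf (lt_of_lt_of_le hy this)
    | compl t ht ih =>
      have : (fun q : DomProb => q.toMeasure tᶜ) = fun q => 1 - q.toMeasure t := by
        funext q
        rw [prob_compl_eq_one_sub ht]
      rw [this]
      exact measurable_const.sub ih
    | iUnion g hd hm ih =>
      have : (fun q : DomProb => q.toMeasure (⋃ i, g i)) = fun q => ∑' i, q.toMeasure (g i) := by
        funext q
        rw [measure_iUnion hd hm]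
      rw [this]
      exact Measurable.tsum ih
  exact Measure.measurable_of_measurable_coe _ h

/-- Jointly measurable versions of the densities exist: differentiate along shrinking balls. -/
theorem exists_isDensityVersion : ∃ f, IsDensityVersion f := by
  let κ : Kernel DomProb ℝ := ⟨toMeasure, measurable_toMeasure⟩
  have hκ : IsMarkovKernel κ := ⟨fun q => inferInstanceAs (IsProbabilityMeasure q.toMeasure)⟩
  let g : ℕ → DomProb → ℝ → ℝ≥0∞ := fun n q x =>
    q.toMeasure (Metric.closedBall x (1 / ((n : ℝ) + 1))) /
      volume (Metric.closedBall x (1 / ((n : ℝ) + 1)))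
  refine ⟨fun q x => limsup (fun n => g n q x) atTop, ?_, fun q => ?_⟩
  · refine Measurable.limsup fun n => ?_
    have hs : MeasurableSet {z : (DomProb × ℝ) × ℝ | dist z.2 z.1.2 ≤ 1 / ((n : ℝ) + 1)} :=
      measurableSet_le (measurable_snd.dist (measurable_snd.comp measurable_fst)) measurable_const
    have h1 := Kernel.measurable_kernel_prodMk_left (κ := κ.prodMkRight ℝ) hs
    have h2 : Measurable fun z : DomProb × ℝ =>
        z.1.toMeasure (Metric.closedBall z.2 (1 / ((n : ℝ) + 1))) := h1
    simp only [Real.volume_closedBall, g]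
    exact h2.div measurable_const
  · have hac : q.toMeasure ≪ volume := q.2
    have hae : (fun x => limsup (fun n => g n q x) atTop) =ᵐ[volume]
        q.toMeasure.rnDeriv volume := by
      filter_upwards [Besicovitch.ae_tendsto_rnDeriv q.toMeasure volume] with x hx
      have ht : Tendsto (fun n : ℕ => 1 / ((n : ℝ) + 1)) atTop (𝓝[>] 0) :=
        tendsto_nhdsWithin_iff.2 ⟨tendsto_one_div_add_atTop_nhds_zero_nat,
          Eventually.of_forall fun n => Set.mem_Ioi.2 Nat.one_div_pos_of_nat⟩
      exact (hx.comp ht).limsup_eq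
    rw [withDensity_congr_ae hae, Measure.withDensity_rnDeriv_eq _ _ hac]

end DomProb

open scoped BoundedContinuousFunction

/-! An open model has only one candidate for an L-projection with finite value: the true density
`r`. If `q` is such a projection, then `(1 - t) q + t r` lies in `Φ` for small `t > 0`, and if `q ≠
r`, this move strictly lowers `L(· ‖ r)`, by concavity of `log` and `∫ (q / r) dr ≤ 1`. So `r ∈ Φ`,
the union of balls is a weak neighbourhood of `r`, and the claim becomes Schwartz's consistency
theorem (`IsDensityVersion.ae_tendsto_posterior`).

After division by the likelihood of `r`, the posterior is a quotient of integrated likelihood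
ratios. The one over `Uᶜ` decays exponentially (`IsDensityVersion.ae_tendsto_compl`): finitely many
half-spaces `{q | ∫ g dq ≤ ∫ g dr - η}` cover `Uᶜ`, and on each an exponential tilt separates `r`
from all `q`; Markov-type summability and the strong law finish. The one over `Φ` decays slower than
every exponential (`IsDensityVersion.ae_tendsto_top`): the prior charges each `B_δ(r, r)`, where the
likelihood ratio eventually exceeds `exp (-n δ)`, and Fatou integrates this. Small `B_δ(r, r)` lie
in `Φ` by a variational bound (`IsDensityVersion.exists_LBall_subset`). -/

/-! ### Positive and negative parts of logarithms -/

/-- If the integrals of the positive and the negative part of `log u` are both finite, then `log u`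
is integrable and its integral is their difference. -/
theorem integrable_log_toReal {α : Type*} [MeasurableSpace α] {μ : Measure α} {u : α → ℝ≥0∞}
    (hu : Measurable u) (ha : ∫⁻ x, (ENNReal.log (u x)).toENNReal ∂μ ≠ ⊤)
    (hb : ∫⁻ x, (-ENNReal.log (u x)).toENNReal ∂μ ≠ ⊤) :
    (∀ᵐ x ∂μ, u x ≠ 0 ∧ u x ≠ ⊤) ∧ Integrable (fun x => Real.log (u x).toReal) μ ∧
      ∫ x, Real.log (u x).toReal ∂μ = (∫⁻ x, (ENNReal.log (u x)).toENNReal ∂μ).toReal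
        - (∫⁻ x, (-ENNReal.log (u x)).toENNReal ∂μ).toReal := by
  have hma : Measurable fun x => (ENNReal.log (u x)).toENNReal := by fun_prop
  have hmb : Measurable fun x => (-ENNReal.log (u x)).toENNReal := by fun_prop
  have hfin : ∀ᵐ x ∂μ, u x ≠ 0 ∧ u x ≠ ⊤ := by
    filter_upwards [ae_lt_top hma ha, ae_lt_top hmb hb] with x h1 h2
    constructor
    · rintro h
      simp [h] at h2
    · rintro h
      simp [h] at h1
  have ea : ∫⁻ x, ENNReal.ofReal (Real.log (u x).toReal) ∂μ
      = ∫⁻ x, (ENNReal.log (u x)).toENNReal ∂μ := by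
    refine lintegral_congr_ae ?_
    filter_upwards [hfin] with x hx
    rw [ENNReal.log_pos_real hx.1 hx.2, EReal.real_coe_toENNReal]
  have eb : ∫⁻ x, ENNReal.ofReal (-Real.log (u x).toReal) ∂μ
      = ∫⁻ x, (-ENNReal.log (u x)).toENNReal ∂μ := by
    refine lintegral_congr_ae ?_
    filter_upwards [hfin] with x hx
    rw [ENNReal.log_pos_real hx.1 hx.2, ← EReal.coe_neg, EReal.real_coe_toENNReal]
  have hint : Integrable (fun x => Real.log (u x).toReal) μ := by
    refine ⟨(Real.measurable_log.comp hu.ennreal_toReal).aestronglyMeasurable, ?_⟩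
    rw [hasFiniteIntegral_iff_norm]
    have : ∀ x, ENNReal.ofReal ‖Real.log (u x).toReal‖
        = ENNReal.ofReal (Real.log (u x).toReal) + ENNReal.ofReal (-Real.log (u x).toReal) := by
      intro x
      rcases le_total 0 (Real.log (u x).toReal) with h | h
      · rw [Real.norm_of_nonneg h, ENNReal.ofReal_of_nonpos (neg_nonpos.2 h), add_zero]
      · rw [Real.norm_of_nonpos h, ENNReal.ofReal_of_nonpos h, zero_add]
    simp_rw [this]
    rw [lintegral_add_left (by fun_prop), ea, eb]
    exact ENNReal.add_lt_top.2 ⟨ha.lt_top, hb.lt_top⟩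
  exact ⟨hfin, hint, by rw [integral_eq_lintegral_pos_part_sub_lintegral_neg_part hint, ea, eb]⟩

/-- From `log (u / v) ≤ u / v - 1`. With `v` the true density, it dominates the positive part of
`log q` by that of `log r` plus the likelihood ratio. -/
theorem ENNReal.toENNReal_log_le_add_div {u v : ℝ≥0∞} (h0 : v ≠ 0) (ht : v ≠ ⊤) :
    (ENNReal.log u).toENNReal ≤ (ENNReal.log v).toENNReal + u * v⁻¹ := by
  rcases eq_or_ne u 0 with rfl | hu0
  · simp
  rcases eq_or_ne u ⊤ with rfl | hut
  · simp [ENNReal.top_mul, ht]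
  have hu : 0 < u.toReal := ENNReal.toReal_pos hu0 hut
  have hv : 0 < v.toReal := ENNReal.toReal_pos h0 ht
  have e : u * v⁻¹ = ENNReal.ofReal (u.toReal / v.toReal) := by
    rw [ENNReal.ofReal_div_of_pos hv, ENNReal.ofReal_toReal hut, ENNReal.ofReal_toReal ht,
      ENNReal.div_eq_inv_mul, mul_comm]
  rw [ENNReal.log_pos_real hu0 hut, ENNReal.log_pos_real h0 ht, e, EReal.real_coe_toENNReal,
    EReal.real_coe_toENNReal]
  refine le_trans (ENNReal.ofReal_le_ofReal ?_) ENNReal.ofReal_add_le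
  have := Real.log_le_sub_one_of_pos (div_pos hu hv)
  rw [Real.log_div hu.ne' hv.ne'] at this
  linarith

theorem ENNReal.toENNReal_neg_log_le_add {u v c : ℝ≥0∞} (h : c * v ≤ u) :
    (-ENNReal.log u).toENNReal ≤ (-ENNReal.log c).toENNReal + (-ENNReal.log v).toENNReal := by
  rw [← ENNReal.log_inv, ← ENNReal.log_inv, ← ENNReal.log_inv]
  -- The forms `0 * ⊤`, where `log` of a product and its inverse misbehave; there the right side is
  -- infinite.
  by_cases hs : (c = 0 ∧ v = ⊤) ∨ (c = ⊤ ∧ v = 0)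
  · rcases hs with ⟨rfl, rfl⟩ | ⟨rfl, rfl⟩ <;> simp
  refine le_trans (EReal.toENNReal_le_toENNReal ?_) EReal.toENNReal_add_le
  rw [← ENNReal.log_mul_add]
  refine ENNReal.log_le_log ((ENNReal.inv_le_inv.2 h).trans_eq ?_)
  rw [ENNReal.mul_inv]
  · by_contra! h'; exact hs (Or.inl h')
  · by_contra! h'; exact hs (Or.inr h')

/-! ### The L-divergence as a real integral -/

namespace DomProb

theorem IsDensityVersion.measurable_apply {f : DomProb → ℝ → ℝ≥0∞} (hf : IsDensityVersion f)
    (q : DomProb) : Measurable (f q) :=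
  hf.measurable.comp measurable_prodMk_left

theorem IsDensityVersion.pdf_ae_eq {f : DomProb → ℝ → ℝ≥0∞} (hf : IsDensityVersion f)
    (q p : DomProb) : q.pdf =ᵐ[p.toMeasure] f q := by
  have hp : p.toMeasure ≪ volume := p.2
  refine hp.ae_eq ?_
  have := Measure.rnDeriv_withDensity volume (hf.measurable_apply q)
  rwa [hf.withDensity_eq q] at this

theorem IsDensityVersion.Ldiv_eq {f : DomProb → ℝ → ℝ≥0∞} (hf : IsDensityVersion f)
    (q p : DomProb) :
    Ldiv q p = -(((∫⁻ x, (ENNReal.log (f q x)).toENNReal ∂p.toMeasure : ℝ≥0∞) : EReal)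
      - ((∫⁻ x, (-ENNReal.log (f q x)).toENNReal ∂p.toMeasure : ℝ≥0∞) : EReal)) := by
  have h := hf.pdf_ae_eq q p
  have h1 : ∫⁻ x, (ENNReal.log (q.pdf x)).toENNReal ∂p.toMeasure
      = ∫⁻ x, (ENNReal.log (f q x)).toENNReal ∂p.toMeasure :=
    lintegral_congr_ae (h.mono fun x hx => by simp only [hx])
  have h2 : ∫⁻ x, (-ENNReal.log (q.pdf x)).toENNReal ∂p.toMeasure
      = ∫⁻ x, (-ENNReal.log (f q x)).toENNReal ∂p.toMeasure :=
    lintegral_congr_ae (h.mono fun x hx => by simp only [hx])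
  rw [Ldiv, h1, h2]

/-- An infinite negative part forces the value `⊤` whatever the positive part is, because `⊤` is
also the value of an undefined integral. -/
theorem IsDensityVersion.lintegral_neg_log_ne_top {f : DomProb → ℝ → ℝ≥0∞}
    (hf : IsDensityVersion f) {q p : DomProb} (h : Ldiv q p ≠ ⊤) :
    ∫⁻ x, (-ENNReal.log (f q x)).toENNReal ∂p.toMeasure ≠ ⊤ := by
  intro hb
  rw [hf.Ldiv_eq, hb] at h
  simp [sub_eq_add_neg] at h

theorem IsDensityVersion.measurable_Ldiv {f : DomProb → ℝ → ℝ≥0∞} (hf : IsDensityVersion f)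
    (p : DomProb) : Measurable fun q => Ldiv q p := by
  simp_rw [hf.Ldiv_eq]
  have h1 : Measurable fun q => ∫⁻ x, (ENNReal.log (f q x)).toENNReal ∂p.toMeasure :=
    Measurable.lintegral_prod_right'
      (f := fun z : DomProb × ℝ => (ENNReal.log (f z.1 z.2)).toENNReal)
      (ENNReal.measurable_log.comp hf.measurable).ereal_toENNReal
  have h2 : Measurable fun q => ∫⁻ x, (-ENNReal.log (f q x)).toENNReal ∂p.toMeasure :=
    Measurable.lintegral_prod_right'
      (f := fun z : DomProb × ℝ => (-ENNReal.log (f z.1 z.2)).toENNReal)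
      (ENNReal.measurable_log.comp hf.measurable).neg.ereal_toENNReal
  simp only [sub_eq_add_neg]
  exact (h1.coe_ereal_ennreal.add h2.coe_ereal_ennreal.neg).neg

theorem IsDensityVersion.Ldiv_finite {f : DomProb → ℝ → ℝ≥0∞} (hf : IsDensityVersion f)
    {q p : DomProb} (h : Ldiv q p ≠ ⊤) (h' : Ldiv q p ≠ ⊥) :
    (∀ᵐ x ∂p.toMeasure, f q x ≠ 0 ∧ f q x ≠ ⊤) ∧
      Integrable (fun x => Real.log (f q x).toReal) p.toMeasure ∧
      Ldiv q p = ((-∫ x, Real.log (f q x).toReal ∂p.toMeasure : ℝ) : EReal) := by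
  have hb := hf.lintegral_neg_log_ne_top h
  have ha : ∫⁻ x, (ENNReal.log (f q x)).toENNReal ∂p.toMeasure ≠ ⊤ := by
    intro ha
    rw [hf.Ldiv_eq, ha] at h'
    lift ∫⁻ x, (-ENNReal.log (f q x)).toENNReal ∂p.toMeasure to NNReal using hb with b
    apply h'
    simp only [EReal.coe_ennreal_top]
    change -((⊤ : EReal) - ((b : ℝ) : EReal)) = ⊥
    simp
  obtain ⟨h1, h2, h3⟩ := integrable_log_toReal (hf.measurable_apply q) ha hb
  refine ⟨h1, h2, ?_⟩
  rw [h3, hf.Ldiv_eq]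
  lift ∫⁻ x, (-ENNReal.log (f q x)).toENNReal ∂p.toMeasure to NNReal using hb with b
  lift ∫⁻ x, (ENNReal.log (f q x)).toENNReal ∂p.toMeasure to NNReal using ha with a
  rfl

/-- The likelihood ratio has expectation at most one, also after a change of measure. -/
theorem IsDensityVersion.lintegral_ratio_mul_le {f : DomProb → ℝ → ℝ≥0∞} (hf : IsDensityVersion f)
    (q r : DomProb) {w : ℝ → ℝ≥0∞} (hw : Measurable w) :
    ∫⁻ x, f q x * (f r x)⁻¹ * w x ∂r.toMeasure ≤ ∫⁻ x, w x ∂q.toMeasure := by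
  have hq := hf.measurable_apply q
  have hr := hf.measurable_apply r
  rw [← hf.withDensity_eq q, ← hf.withDensity_eq r,
    lintegral_withDensity_eq_lintegral_mul _ hr (by fun_prop),
    lintegral_withDensity_eq_lintegral_mul _ hq hw]
  refine lintegral_mono fun x => ?_
  calc f r x * (f q x * (f r x)⁻¹ * w x) = (f r x * (f r x)⁻¹) * (f q x * w x) := by ring
    -- Equality fails only where `f r x` is `0` or `⊤`: there the factor is `0`, and mass of `q` may
    -- be lost.
    _ ≤ 1 * (f q x * w x) := by gcongr; exact ENNReal.mul_inv_le_one _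
    _ = f q x * w x := one_mul _

theorem IsDensityVersion.ae_pos_finite {f : DomProb → ℝ → ℝ≥0∞} (hf : IsDensityVersion f)
    (r : DomProb) : ∀ᵐ x ∂r.toMeasure, f r x ≠ 0 ∧ f r x ≠ ⊤ := by
  have hr := hf.measurable_apply r
  have h1 : ∀ᵐ x ∂volume, f r x < ⊤ := by
    refine ae_lt_top hr ?_
    rw [← setLIntegral_univ, ← withDensity_apply _ MeasurableSet.univ, hf.withDensity_eq]
    simp
  have hac : r.toMeasure ≪ volume := r.2
  have h2 : ∀ᵐ x ∂r.toMeasure, f r x ≠ 0 := by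
    rw [← hf.withDensity_eq r, ae_withDensity_iff hr]
    exact Eventually.of_forall fun x hx => hx
  filter_upwards [h2, hac.ae_le h1] with x hx hx' using ⟨hx, hx'.ne⟩

/-- Since `log q ≤ log r + q / r` and the ratio has `r`-mean at most one, the positive part of `log
q` is `r`-integrable as soon as that of `log r` is. -/
theorem IsDensityVersion.Ldiv_ne_bot {f : DomProb → ℝ → ℝ≥0∞} (hf : IsDensityVersion f)
    {q r : DomProb} (hr : Ldiv r r ≠ ⊤) (hr' : Ldiv r r ≠ ⊥) (hq : Ldiv q r ≠ ⊤) :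
    Ldiv q r ≠ ⊥ := by
  have hb := hf.lintegral_neg_log_ne_top hq
  have har : ∫⁻ x, (ENNReal.log (f r x)).toENNReal ∂r.toMeasure ≠ ⊤ := by
    have := (hf.Ldiv_finite hr hr').2.1.lintegral_lt_top.ne
    rwa [lintegral_congr_ae ((hf.ae_pos_finite r).mono fun x hx => ?_)] at this
    rw [ENNReal.log_pos_real hx.1 hx.2, EReal.real_coe_toENNReal]
  have ha : ∫⁻ x, (ENNReal.log (f q x)).toENNReal ∂r.toMeasure ≠ ⊤ := by
    refine ne_top_of_le_ne_top (b := ∫⁻ x, (ENNReal.log (f r x)).toENNReal ∂r.toMeasure + 1)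
      (by finiteness) ?_
    have h1 := hf.lintegral_ratio_mul_le q r (w := fun _ => 1) measurable_const
    simp only [mul_one, lintegral_const, measure_univ] at h1
    have := hf.measurable_apply r
    refine le_trans (lintegral_mono_ae ((hf.ae_pos_finite r).mono fun x hx =>
      ENNReal.toENNReal_log_le_add_div (u := f q x) hx.1 hx.2)) ?_
    rw [lintegral_add_left (by fun_prop)]
    gcongr
  rw [hf.Ldiv_eq]
  lift ∫⁻ x, (-ENNReal.log (f q x)).toENNReal ∂r.toMeasure to NNReal using hb with b
  lift ∫⁻ x, (ENNReal.log (f q x)).toENNReal ∂r.toMeasure to NNReal using ha with a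
  change -(((a : ℝ) : EReal) - ((b : ℝ) : EReal)) ≠ ⊥
  rw [← EReal.coe_sub, ← EReal.coe_neg]
  exact EReal.coe_ne_bot _

/-! ### The weak topology through test functions -/

theorem tendsto_iff_forall_integral_tendsto {γ : Type*} {F : Filter γ} {u : γ → DomProb}
    {q : DomProb} : Tendsto u F (𝓝 q) ↔
      ∀ g : ℝ →ᵇ ℝ, Tendsto (fun i => ∫ x, g x ∂(u i).toMeasure) F (𝓝 (∫ x, g x ∂q.toMeasure)) := by
  have h : Tendsto u F (𝓝 q) ↔ Tendsto (fun i => (u i).1) F (𝓝 q.1) :=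
    Topology.IsInducing.tendsto_nhds_iff (f := u)
      (g := (Subtype.val : {q : ProbabilityMeasure ℝ // (q : Measure ℝ) ≪ (volume : Measure ℝ)} → _))
      Topology.IsInducing.subtypeVal
  rw [h, ProbabilityMeasure.tendsto_iff_forall_integral_tendsto]
  rfl

theorem continuous_integral (g : ℝ →ᵇ ℝ) : Continuous fun q : DomProb => ∫ x, g x ∂q.toMeasure :=
  continuous_iff_continuousAt.2 fun _ => tendsto_iff_forall_integral_tendsto.1 tendsto_id g

/-- Lower bounds suffice, as `-g` supplies the upper ones. Half-spaces thus form a subbase of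
neighbourhoods at `r`. -/
theorem nhds_le_of_forall_lt {F : Filter DomProb} {r : DomProb}
    (h : ∀ g : ℝ →ᵇ ℝ, ∀ η > 0, ∀ᶠ q in F, ∫ x, g x ∂r.toMeasure - η < ∫ x, g x ∂q.toMeasure) :
    F ≤ 𝓝 r := by
  refine tendsto_iff_forall_integral_tendsto.2 fun g => tendsto_order.2 ⟨fun a ha => ?_, fun a ha => ?_⟩
  · filter_upwards [h g _ (sub_pos.2 ha)] with q hq
    simpa using hq
  · filter_upwards [h (-g) _ (sub_pos.2 ha)] with q hq
    simp only [BoundedContinuousFunction.coe_neg, Pi.neg_apply, integral_neg] at hq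
    linarith

/-! ### Divergence balls inside weak neighbourhoods -/

/-- A variational lower bound for the Kullback–Leibler divergence. -/
theorem IsDensityVersion.integral_exp_gt {f : DomProb → ℝ → ℝ≥0∞} (hf : IsDensityVersion f)
    {q r : DomProb} (hr : Ldiv r r ≠ ⊤) (hr' : Ldiv r r ≠ ⊥) {δ : ℝ} (hq : q ∈ LBall δ r r)
    {h : ℝ → ℝ} (hm : Measurable h) (hi : Integrable h r.toMeasure)
    (hie : Integrable (fun x => Real.exp (h x)) q.toMeasure) :
    1 + ∫ x, h x ∂r.toMeasure - δ < ∫ x, Real.exp (h x) ∂q.toMeasure := by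
  have hqt : Ldiv q r ≠ ⊤ := (lt_of_lt_of_le (show Ldiv q r < _ from hq) le_top).ne
  obtain ⟨r1, r2, r3⟩ := hf.Ldiv_finite hr hr'
  obtain ⟨q1, q2, q3⟩ := hf.Ldiv_finite hqt (hf.Ldiv_ne_bot hr hr' hqt)
  have hlt : Ldiv q r < Ldiv r r + δ := hq
  rw [q3, r3, ← EReal.coe_add, EReal.coe_lt_coe_iff] at hlt
  have hle := hf.lintegral_ratio_mul_le q r (w := fun x => ENNReal.ofReal (Real.exp (h x)))
    (by fun_prop)
  rw [← ofReal_integral_eq_lintegral_ofReal hie (ae_of_all _ fun x => (Real.exp_pos _).le)] at hle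
  set G : ℝ → ℝ≥0∞ := fun x => f q x * (f r x)⁻¹ * ENNReal.ofReal (Real.exp (h x)) with hG
  have mq := hf.measurable_apply q
  have mr := hf.measurable_apply r
  have hGm : Measurable G := by fun_prop
  have hGt : ∫⁻ x, G x ∂r.toMeasure ≠ ⊤ := ne_top_of_le_ne_top ENNReal.ofReal_ne_top hle
  have hGi := integrable_toReal_of_lintegral_ne_top hGm.aemeasurable hGt
  have hG' : ∫ x, (G x).toReal ∂r.toMeasure ≤ ∫ x, Real.exp (h x) ∂q.toMeasure := by
    rw [integral_toReal hGm.aemeasurable (ae_lt_top hGm hGt)]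
    refine ENNReal.toReal_le_of_le_ofReal (integral_nonneg fun x => (Real.exp_pos _).le) hle
  -- The left integrand is `log G`, so this is `log y ≤ y - 1` integrated against `r`.
  have hmain : ∫ x, (h x + (Real.log (f q x).toReal - Real.log (f r x).toReal)) ∂r.toMeasure
      ≤ ∫ x, ((G x).toReal - 1) ∂r.toMeasure := by
    refine integral_mono_ae (hi.add (q2.sub r2)) (hGi.sub (integrable_const _)) ?_
    filter_upwards [r1, q1] with x hx hx'
    have hu : 0 < (f q x).toReal := ENNReal.toReal_pos hx'.1 hx'.2
    have hv : 0 < (f r x).toReal := ENNReal.toReal_pos hx.1 hx.2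
    simp only [hG, ENNReal.toReal_mul, ENNReal.toReal_inv, ENNReal.toReal_ofReal (Real.exp_pos _).le]
    have := Real.log_le_sub_one_of_pos (mul_pos (mul_pos hu (inv_pos.2 hv)) (Real.exp_pos (h x)))
    rw [Real.log_mul (by positivity) (by positivity), Real.log_mul (by positivity) (by positivity),
      Real.log_inv, Real.log_exp] at this
    linarith
  have e1 := integral_add hi (q2.sub r2)
  have e2 := integral_sub q2 r2
  have e3 := integral_sub hGi (integrable_const (μ := r.toMeasure) (1 : ℝ))
  simp only [Pi.sub_apply] at e1
  rw [e1, e2, e3] at hmain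
  simp only [integral_const, probReal_univ, smul_eq_mul, mul_one] at hmain
  linarith

/-- Second-order expansion: `exp y ≤ 1 + y + y ^ 2` for `|y| ≤ 1`. -/
theorem integral_exp_le {μ : Measure ℝ} [IsProbabilityMeasure μ] {h : ℝ → ℝ} (hm : Measurable h)
    {c : ℝ} (hc : c ≤ 1) (hb : ∀ x, |h x| ≤ c) :
    ∫ x, Real.exp (h x) ∂μ ≤ 1 + ∫ x, h x ∂μ + c ^ 2 := by
  have hi : Integrable h μ := Integrable.of_bound hm.aestronglyMeasurable c (ae_of_all _ hb)
  have hi1 : Integrable (fun x => 1 + h x) μ := (integrable_const _).add hi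
  calc ∫ x, Real.exp (h x) ∂μ ≤ ∫ x, (1 + h x + c ^ 2) ∂μ := by
        refine integral_mono_of_nonneg (ae_of_all _ fun x => (Real.exp_pos _).le)
          (hi1.add (integrable_const _)) (ae_of_all _ fun x => ?_)
        have h1 := (abs_le.1 (Real.abs_exp_sub_one_sub_id_le ((hb x).trans hc))).2
        have h2 : h x ^ 2 ≤ c ^ 2 := sq_le_sq' (abs_le.1 (hb x)).1 (abs_le.1 (hb x)).2
        simp only
        linarith
    _ = 1 + ∫ x, h x ∂μ + c ^ 2 := by
        have e1 := integral_add hi1 (integrable_const (μ := μ) (c ^ 2))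
        have e2 := integral_add (integrable_const (μ := μ) (1 : ℝ)) hi
        rw [e1, e2]
        simp

/-- Every weak neighbourhood of `r` contains a ball `B_δ(r, r)`. -/
theorem IsDensityVersion.exists_LBall_subset {f : DomProb → ℝ → ℝ≥0∞} (hf : IsDensityVersion f)
    {r : DomProb} (hr : Ldiv r r ≠ ⊤) (hr' : Ldiv r r ≠ ⊥) {V : Set DomProb} (hV : V ∈ 𝓝 r) :
    ∃ δ₀ > 0, ∀ δ ≤ δ₀, LBall δ r r ⊆ V := by
  -- The filter generated by the balls `B_δ(r, r)` refines `𝓝 r`; in this form only half-spaces need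
  -- checking.
  have key : comap (fun q => Ldiv q r) (⨅ δ > (0 : ℝ), 𝓟 (Set.Iio (Ldiv r r + δ))) ≤ 𝓝 r := by
    refine nhds_le_of_forall_lt fun g η hη => ?_
    set M := ‖g‖ + 1
    have hM : 0 < M := by positivity
    -- the scale of the exponential tilt
    obtain ⟨t, ht, htM, htη⟩ : ∃ t > 0, t * M ≤ 1 ∧ t * M ^ 2 ≤ η / 2 := by
      refine ⟨min (1 / M) (η / 2 / M ^ 2), by positivity, ?_, ?_⟩
      · rw [← le_div_iff₀ hM]; exact min_le_left _ _
      · rw [← le_div_iff₀ (by positivity)]; exact min_le_right _ _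
    -- The total loss `t * η` is split equally: `t * η / 2` for the divergence and at most as much
    -- for the quadratic error `(t * M) ^ 2`.
    have hδ : 0 < t * η / 2 := by positivity
    refine mem_of_superset (preimage_mem_comap (mem_iInf_of_mem _ (mem_iInf_of_mem hδ
      (mem_principal_self _)))) fun q hq => ?_
    have hgb : ∀ x, |t * g x| ≤ t * M := fun x => by
      rw [abs_mul, abs_of_pos ht]
      have := g.norm_coe_le_norm x
      rw [Real.norm_eq_abs] at this
      gcongr
      linarith
    have hgm : Measurable fun x => t * g x := by fun_prop
    have e1 := hf.integral_exp_gt hr hr' (show q ∈ LBall (t * η / 2) r r from hq) hgm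
      (Integrable.of_bound hgm.aestronglyMeasurable _ (ae_of_all _ hgb))
      (Integrable.of_bound hgm.exp.aestronglyMeasurable (Real.exp (t * M))
        (ae_of_all _ fun x => by
          rw [Real.norm_of_nonneg (Real.exp_pos _).le]
          exact Real.exp_le_exp.2 ((le_abs_self _).trans (hgb x))))
    have e2 := integral_exp_le (μ := q.toMeasure) hgm htM hgb
    rw [integral_const_mul] at e1 e2
    have e3 : t * (∫ x, g x ∂r.toMeasure - η) < t * ∫ x, g x ∂q.toMeasure := by nlinarith
    exact lt_of_mul_lt_mul_left e3 ht.le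
  obtain ⟨W, hW, hWV⟩ := key hV
  have hbasis : (⨅ δ > (0 : ℝ), 𝓟 (Set.Iio (Ldiv r r + δ))).HasBasis (fun δ : ℝ => 0 < δ)
      fun δ => Set.Iio (Ldiv r r + δ) := by
    refine hasBasis_biInf_principal (fun a ha b hb => ?_) ⟨1, show (0 : ℝ) < 1 from one_pos⟩
    refine ⟨min a b, show (0 : ℝ) < min a b from lt_min ha hb, ?_, ?_⟩ <;>
    · refine Set.Iio_subset_Iio (add_le_add_right (EReal.coe_le_coe_iff.2 ?_) _)
      simp
  obtain ⟨δ₀, h0, hδ⟩ := hbasis.mem_iff.1 hW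
  refine ⟨δ₀, h0, fun δ hle q hq => hWV (hδ ?_)⟩
  exact lt_of_lt_of_le (show Ldiv q r < _ from hq) (add_le_add_right (EReal.coe_le_coe_iff.2 hle) _)

/-! ### Mixtures, and L-projections on open models -/

/-- The mixture `(1 - t) q + t r`. -/
noncomputable def mix (t : unitInterval) (q r : DomProb) : DomProb :=
  ⟨⟨ENNReal.ofReal (1 - t) • q.toMeasure + ENNReal.ofReal t • r.toMeasure, ⟨by
      have h1 : 0 ≤ 1 - (t : ℝ) := sub_nonneg.2 t.2.2
      simp only [Measure.coe_add, Measure.coe_smul, Pi.add_apply, Pi.smul_apply, measure_univ,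
        smul_eq_mul, mul_one]
      rw [← ENNReal.ofReal_add h1 t.2.1]
      simp⟩⟩,
    Measure.AbsolutelyContinuous.add_left
      ((show q.toMeasure ≪ volume from q.2).smul_left _)
      ((show r.toMeasure ≪ volume from r.2).smul_left _)⟩

theorem toMeasure_mix (t : unitInterval) (q r : DomProb) : (mix t q r).toMeasure =
    ENNReal.ofReal (1 - t) • q.toMeasure + ENNReal.ofReal t • r.toMeasure := rfl

theorem tendsto_mix (q r : DomProb) : Tendsto (fun t => mix t q r) (𝓝 0) (𝓝 q) := by
  refine tendsto_iff_forall_integral_tendsto.2 fun g => ?_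
  have hg : ∀ p : DomProb, Integrable g p.toMeasure := fun p => g.integrable _
  have h : ∀ t : unitInterval, ∫ x, g x ∂(mix t q r).toMeasure
      = (1 - t) * ∫ x, g x ∂q.toMeasure + t * ∫ x, g x ∂r.toMeasure := fun t => by
    rw [toMeasure_mix, integral_add_measure ((hg q).smul_measure ENNReal.ofReal_ne_top)
      ((hg r).smul_measure ENNReal.ofReal_ne_top), integral_smul_measure, integral_smul_measure,
      ENNReal.toReal_ofReal (sub_nonneg.2 t.2.2), ENNReal.toReal_ofReal t.2.1]
    rfl
  simp_rw [h]
  have hc : Continuous fun t : unitInterval =>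
      (1 - (t : ℝ)) * ∫ x, g x ∂q.toMeasure + t * ∫ x, g x ∂r.toMeasure := by fun_prop
  simpa using hc.tendsto 0

theorem IsDensityVersion.mix_ae_eq {f : DomProb → ℝ → ℝ≥0∞} (hf : IsDensityVersion f)
    (t : unitInterval) (q r : DomProb) : f (mix t q r) =ᵐ[volume]
      fun x => ENNReal.ofReal (1 - t) * f q x + ENNReal.ofReal t * f r x := by
  have hq := hf.measurable_apply q
  have hr := hf.measurable_apply r
  refine (withDensity_eq_iff_of_sigmaFinite (hf.measurable_apply _).aemeasurable
    (by fun_prop)).1 ?_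
  rw [hf.withDensity_eq, toMeasure_mix, ← hf.withDensity_eq q, ← hf.withDensity_eq r,
    ← withDensity_smul _ hq, ← withDensity_smul _ hr, ← withDensity_add_left (by fun_prop)]
  rfl

end DomProb

/-- For the mixture `w`, use `log (u / w) < u / w - 1` and convexity of the reciprocal, `u / w ≤ (1
- t) + t * (u / v)`. The lower bound has nonnegative `r`-mean when `u / v` is the likelihood ratio
`q / r`. -/
theorem Real.mul_one_sub_div_lt_log_mix {u v t : ℝ} (hu : 0 < u) (hv : 0 < v) (ht : 0 < t)
    (ht1 : t < 1) (huv : u ≠ v) :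
    t * (1 - u / v) < Real.log ((1 - t) * u + t * v) - Real.log u := by
  have h1 : 0 < 1 - t := sub_pos.2 ht1
  have hw : 0 < (1 - t) * u + t * v := by positivity
  have hne : u / ((1 - t) * u + t * v) ≠ 1 := by
    rw [Ne, div_eq_one_iff_eq hw.ne']
    intro h
    exact huv (mul_left_cancel₀ ht.ne' (by linarith))
  have hlog := Real.log_lt_sub_one_of_pos (div_pos hu hw) hne
  rw [Real.log_div hu.ne' hw.ne'] at hlog
  have hle : u / ((1 - t) * u + t * v) ≤ 1 - t + t * (u / v) := by
    rw [div_le_iff₀ hw, show (1 - t + t * (u / v)) * ((1 - t) * u + t * v)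
      = u + t * (1 - t) * (u - v) ^ 2 / v by field_simp; ring]
    have : 0 ≤ t * (1 - t) * (u - v) ^ 2 / v := by positivity
    linarith
  linarith

namespace DomProb

theorem IsDensityVersion.Ldiv_ne_top {f : DomProb → ℝ → ℝ≥0∞} (hf : IsDensityVersion f)
    {q p : DomProb} (hb : ∫⁻ x, (-ENNReal.log (f q x)).toENNReal ∂p.toMeasure ≠ ⊤) :
    Ldiv q p ≠ ⊤ := by
  rw [hf.Ldiv_eq]
  lift ∫⁻ x, (-ENNReal.log (f q x)).toENNReal ∂p.toMeasure to NNReal using hb with b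
  rw [Ne, EReal.neg_eq_top_iff]
  change (_ : EReal) - ((b : ℝ) : EReal) ≠ ⊥
  rw [sub_eq_add_neg, ← EReal.coe_neg, Ne, EReal.add_eq_bot_iff, not_or]
  exact ⟨EReal.coe_ennreal_ne_bot _, EReal.coe_ne_bot _⟩

/-- Agreement where `r` lives gives `r ≤ q` as measures, and both have mass one. -/
theorem IsDensityVersion.eq_of_ae_eq {f : DomProb → ℝ → ℝ≥0∞} (hf : IsDensityVersion f)
    {q r : DomProb} (h : ∀ᵐ x ∂r.toMeasure, f q x = f r x) : q = r := by
  rw [← hf.withDensity_eq r, ae_withDensity_iff (hf.measurable_apply r)] at h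
  have hle : r.toMeasure ≤ q.toMeasure := by
    rw [← hf.withDensity_eq r, ← hf.withDensity_eq q]
    refine withDensity_mono (h.mono fun x hx => ?_)
    by_cases h0 : f r x = 0
    · simp [h0]
    · exact (hx h0).ge
  have : r.toMeasure = q.toMeasure := Measure.eq_of_le_of_isProbabilityMeasure hle
  exact Subtype.ext (Subtype.ext this.symm)

/-- An L-projection of `r` on an open model is `r` itself. -/
theorem IsLProjection.eq_of_isOpen {f : DomProb → ℝ → ℝ≥0∞} (hf : IsDensityVersion f)
    {q r : DomProb} {Φ : Set DomProb} (hΦ : IsOpen Φ) (h : IsLProjection q Φ r)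
    (ht : Ldiv q r ≠ ⊤) (hb : Ldiv q r ≠ ⊥) : q = r := by
  obtain ⟨t, hp, ht0, ht1⟩ : ∃ t : unitInterval, mix t q r ∈ Φ ∧ 0 < t ∧ t < 1 := by
    have h1 : ∀ᶠ t in 𝓝[>] (0 : unitInterval), mix t q r ∈ Φ :=
      ((tendsto_mix q r).eventually (hΦ.mem_nhds h.1)).filter_mono nhdsWithin_le_nhds
    have h2 : ∀ᶠ t in 𝓝[>] (0 : unitInterval), 0 < t := self_mem_nhdsWithin
    have h3 : ∀ᶠ t in 𝓝[>] (0 : unitInterval), t < 1 :=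
      mem_nhdsWithin_of_mem_nhds (Iio_mem_nhds zero_lt_one)
    have : (𝓝[>] (0 : unitInterval)).NeBot := nhdsGT_neBot_of_exists_gt ⟨1, zero_lt_one⟩
    exact (h1.and (h2.and h3)).exists
  have ht0 : 0 < (t : ℝ) := ht0
  have ht1 : (t : ℝ) < 1 := ht1
  set p := mix t q r with hpdef
  have hac : r.toMeasure ≪ volume := r.2
  have hmix : ∀ᵐ x ∂r.toMeasure,
      f p x = ENNReal.ofReal (1 - t) * f q x + ENNReal.ofReal t * f r x :=
    hac.ae_le (hf.mix_ae_eq t q r)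
  -- The mixture density is at least `(1 - t) q`, so its negative logarithmic part exceeds that of
  -- `q` by at most a constant.
  have hpt : Ldiv p r ≠ ⊤ := by
    refine hf.Ldiv_ne_top (ne_top_of_le_ne_top (b := (-ENNReal.log (ENNReal.ofReal (1 - t))).toENNReal
      + ∫⁻ x, (-ENNReal.log (f q x)).toENNReal ∂r.toMeasure) ?_ ?_)
    · refine ENNReal.add_ne_top.2 ⟨?_, hf.lintegral_neg_log_ne_top ht⟩
      rw [ENNReal.log_ofReal_of_pos (sub_pos.2 ht1), ← EReal.coe_neg, EReal.real_coe_toENNReal]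
      exact ENNReal.ofReal_ne_top
    · refine le_trans (lintegral_mono_ae (hmix.mono fun x hx =>
        ENNReal.toENNReal_neg_log_le_add
          (c := ENNReal.ofReal (1 - t)) (v := f q x) ?_)) ?_
      · rw [hx]
        exact le_self_add
      · rw [lintegral_add_left measurable_const]
        simp
  have hpb : Ldiv p r ≠ ⊥ := ((bot_lt_iff_ne_bot.2 hb).trans_le (h.2 p hp)).ne'
  obtain ⟨q1, q2, q3⟩ := hf.Ldiv_finite ht hb
  obtain ⟨-, p2, p3⟩ := hf.Ldiv_finite hpt hpb
  have hle := h.2 p hp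
  rw [q3, p3, EReal.coe_le_coe_iff] at hle
  have mq := hf.measurable_apply q
  have mr := hf.measurable_apply r
  have hz := hf.lintegral_ratio_mul_le q r (w := fun _ => 1) measurable_const
  simp only [mul_one, lintegral_const, measure_univ] at hz
  have hzm : Measurable fun x => f q x * (f r x)⁻¹ := by fun_prop
  have hzt := ne_top_of_le_ne_top ENNReal.one_ne_top hz
  have hzi := integrable_toReal_of_lintegral_ne_top hzm.aemeasurable hzt
  have hz1 : ∫ x, (f q x * (f r x)⁻¹).toReal ∂r.toMeasure ≤ 1 := by
    rw [integral_toReal hzm.aemeasurable (ae_lt_top hzm hzt)]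
    exact ENNReal.toReal_le_of_le_ofReal zero_le_one (by simpa using hz)
  -- The slack in the pointwise mixture inequality. It is nonnegative, yet minimality of `q` and `∫
  -- (q / r) dr ≤ 1` make its integral nonpositive; so it vanishes `r`-a.e., which forces equal
  -- densities.
  set D : ℝ → ℝ := fun x => (Real.log (f p x).toReal - Real.log (f q x).toReal)
    - t * (1 - (f q x * (f r x)⁻¹).toReal) with hD
  have i1 : Integrable (fun x => Real.log (f p x).toReal - Real.log (f q x).toReal) r.toMeasure :=
    p2.sub q2
  have i2 : Integrable (fun x => 1 - (f q x * (f r x)⁻¹).toReal) r.toMeasure :=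
    (integrable_const _).sub hzi
  have i3 := i2.const_mul (t : ℝ)
  have hDi : Integrable D r.toMeasure := i1.sub i3
  have hDae : ∀ᵐ x ∂r.toMeasure, 0 ≤ D x ∧ (D x = 0 → f q x = f r x) := by
    filter_upwards [hf.ae_pos_finite r, q1, hmix] with x hr hq hx
    have hu : 0 < (f q x).toReal := ENNReal.toReal_pos hq.1 hq.2
    have hv : 0 < (f r x).toReal := ENNReal.toReal_pos hr.1 hr.2
    have hpx : (f p x).toReal = (1 - t) * (f q x).toReal + t * (f r x).toReal := by
      rw [hx, ENNReal.toReal_add (ENNReal.mul_ne_top ENNReal.ofReal_ne_top hq.2)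
        (ENNReal.mul_ne_top ENNReal.ofReal_ne_top hr.2), ENNReal.toReal_mul, ENNReal.toReal_mul,
        ENNReal.toReal_ofReal (sub_pos.2 ht1).le, ENNReal.toReal_ofReal ht0.le]
    have hDx : D x = Real.log ((1 - t) * (f q x).toReal + t * (f r x).toReal)
        - Real.log (f q x).toReal - t * (1 - (f q x).toReal / (f r x).toReal) := by
      simp only [hD, hpx, ENNReal.toReal_mul, ENNReal.toReal_inv, div_eq_mul_inv]
    rw [hDx]
    by_cases huv : (f q x).toReal = (f r x).toReal
    · refine ⟨?_, fun _ => (ENNReal.toReal_eq_toReal_iff' hq.2 hr.2).1 huv⟩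
      rw [huv, div_self hv.ne', show (1 - (t : ℝ)) * (f r x).toReal + t * (f r x).toReal
        = (f r x).toReal by ring]
      simp
    · have := Real.mul_one_sub_div_lt_log_mix hu hv ht0 ht1 huv
      exact ⟨by linarith, fun h => by linarith⟩
  have hD0 : ∫ x, D x ∂r.toMeasure ≤ 0 := by
    have e1 := integral_sub i1 i3
    have e2 := integral_sub p2 q2
    have e3 := integral_sub (integrable_const (μ := r.toMeasure) (1 : ℝ)) hzi
    rw [integral_const_mul, e2, e3] at e1
    simp only [integral_const, probReal_univ, smul_eq_mul, mul_one] at e1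
    rw [hD, e1]
    nlinarith
  have hDnn : 0 ≤ᵐ[r.toMeasure] D := hDae.mono fun x hx => hx.1
  have hDz := (integral_eq_zero_iff_of_nonneg_ae hDnn hDi).1
    (le_antisymm hD0 (integral_nonneg_of_ae hDnn))
  refine hf.eq_of_ae_eq ?_
  filter_upwards [hDae, hDz] with x hx hx0 using hx.2 hx0

end DomProb

/-! ### Strong law for sums of functions of the observations -/

theorem ae_tendsto_average {Ω : Type*} [MeasurableSpace Ω] {P : Measure Ω} {μ : Measure ℝ}
    {X : ℕ → Ω → ℝ} (hX : ∀ i, HasLaw (X i) μ P) (hindep : iIndepFun X P)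
    {g : ℝ → ℝ} (hg : Measurable g) (hi : Integrable g μ) :
    ∀ᵐ ω ∂P, Tendsto (fun n : ℕ => (∑ i ∈ Finset.range n, g (X i ω)) / n) atTop
      (𝓝 (∫ x, g x ∂μ)) := by
  have h := strong_law_ae_real (μ := P) (fun i ω => g (X i ω)) ?_ ?_ ?_
  · have e : ∫ ω, g (X 0 ω) ∂P = ∫ x, g x ∂μ := by
      rw [← (hX 0).map_eq, integral_map (hX 0).aemeasurable hg.aestronglyMeasurable]
    rwa [e] at h
  · rw [← (hX 0).map_eq] at hi
    exact hi.comp_aemeasurable (hX 0).aemeasurable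
  · intro i j hij
    exact (hindep.indepFun hij).comp hg hg
  · intro i
    exact (IdentDistrib.mk (hX i).aemeasurable (hX 0).aemeasurable
      ((hX i).map_eq.trans (hX 0).map_eq.symm)).comp hg

theorem tendsto_sum_atTop_of_average {u : ℕ → ℝ} {m : ℝ} (hm : 0 < m)
    (h : Tendsto (fun n : ℕ => (∑ i ∈ Finset.range n, u i) / n) atTop (𝓝 m)) :
    Tendsto (fun n : ℕ => ∑ i ∈ Finset.range n, u i) atTop atTop := by
  refine (h.pos_mul_atTop hm tendsto_natCast_atTop_atTop).congr' ?_
  filter_upwards [eventually_ne_atTop 0] with n hn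
  rw [div_mul_cancel₀]
  exact_mod_cast hn

theorem ENNReal.prod_ofReal_exp (u : ℕ → ℝ) (n : ℕ) :
    ∏ i ∈ Finset.range n, ENNReal.ofReal (Real.exp (u i))
      = ENNReal.ofReal (Real.exp (∑ i ∈ Finset.range n, u i)) := by
  rw [Real.exp_sum, ENNReal.ofReal_prod_of_nonneg fun i _ => (Real.exp_pos _).le]

/-! ### Integrated likelihood ratios -/

namespace DomProb

variable {Ω : Type*} [MeasurableSpace Ω] {P : Measure Ω}
  {r : DomProb} {X : ℕ → Ω → ℝ} {prior : Measure DomProb}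
  {f : DomProb → ℝ → ℝ≥0∞}

theorem IsDensityVersion.measurable_likelihood (hf : IsDensityVersion f)
    (hXm : ∀ i, Measurable (X i)) (n : ℕ) :
    Measurable fun z : DomProb × Ω => likelihood f (fun i => X i z.2) n z.1 :=
  Finset.measurable_prod _ fun i _ =>
    hf.measurable.comp (measurable_fst.prodMk ((hXm i).comp measurable_snd))

/-- The reciprocal of the likelihood of `r`. -/
noncomputable def invLikelihood (f : DomProb → ℝ → ℝ≥0∞) (r : DomProb) (x : ℕ → ℝ) (n : ℕ) : ℝ≥0∞ :=
  ∏ i ∈ Finset.range n, (f r (x i))⁻¹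

theorem IsDensityVersion.ae_invLikelihood (hf : IsDensityVersion f)
    (hX : ∀ i, HasLaw (X i) r.toMeasure P) :
    ∀ᵐ ω ∂P, ∀ n, invLikelihood f r (fun i => X i ω) n ≠ 0 ∧
      invLikelihood f r (fun i => X i ω) n ≠ ⊤ := by
  have h : ∀ᵐ ω ∂P, ∀ i, f r (X i ω) ≠ 0 ∧ f r (X i ω) ≠ ⊤ := by
    refine ae_all_iff.2 fun i => ?_
    have := hf.ae_pos_finite r
    rw [← (hX i).map_eq] at this
    exact ae_of_ae_map (hX i).aemeasurable this
  filter_upwards [h] with ω hω n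
  refine ⟨Finset.prod_ne_zero_iff.2 fun i _ => ENNReal.inv_ne_zero.2 (hω i).2,
    ENNReal.prod_ne_top fun i _ => ENNReal.inv_ne_top.2 (hω i).1⟩

theorem IsDensityVersion.measurable_invLikelihood (hf : IsDensityVersion f)
    (hXm : ∀ i, Measurable (X i)) (n : ℕ) :
    Measurable fun ω => invLikelihood f r (fun i => X i ω) n :=
  Finset.measurable_prod _ fun i _ => ((hf.measurable_apply r).comp (hXm i)).inv

/-- The expectation of the weighted integrated likelihood ratio. -/
theorem IsDensityVersion.lintegral_integratedLikelihood_le [IsProbabilityMeasure P]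
    [IsProbabilityMeasure prior] (hf : IsDensityVersion f)
    (hX : ∀ i, HasLaw (X i) r.toMeasure P) (hXm : ∀ i, Measurable (X i)) (hindep : iIndepFun X P)
    {A : Set DomProb} (hA : MeasurableSet A) {w : ℝ → ℝ≥0∞} (hw : Measurable w) {ρ : ℝ≥0∞}
    (hρ : ∀ q ∈ A, ∫⁻ x, w x ∂q.toMeasure ≤ ρ) (n : ℕ) :
    ∫⁻ ω, (∏ i ∈ Finset.range n, w (X i ω)) * (invLikelihood f r (fun i => X i ω) n *
      ∫⁻ q in A, likelihood f (fun i => X i ω) n q ∂prior) ∂P ≤ ρ ^ n := by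
  have hl := hf.measurable_likelihood hXm n
  have h1 : ∀ ω, (∏ i ∈ Finset.range n, w (X i ω)) * (invLikelihood f r (fun i => X i ω) n *
      ∫⁻ q in A, likelihood f (fun i => X i ω) n q ∂prior)
      = ∫⁻ q in A, ∏ i ∈ Finset.range n, (f q (X i ω) * (f r (X i ω))⁻¹ * w (X i ω)) ∂prior := by
    intro ω
    have hm : Measurable fun q => likelihood f (fun i => X i ω) n q :=
      hl.comp (measurable_id.prodMk measurable_const)
    rw [← mul_assoc, ← lintegral_const_mul _ hm]
    refine lintegral_congr fun q => ?_
    rw [Finset.prod_mul_distrib, Finset.prod_mul_distrib, invLikelihood, likelihood]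
    ring
  simp_rw [h1]
  have hjm : Measurable fun z : Ω × DomProb =>
      ∏ i ∈ Finset.range n, (f z.2 (X i z.1) * (f r (X i z.1))⁻¹ * w (X i z.1)) := by
    refine Finset.measurable_prod _ fun i _ => ?_
    have hXi : Measurable fun z : Ω × DomProb => X i z.1 := (hXm i).comp measurable_fst
    exact ((hf.measurable.comp (measurable_snd.prodMk hXi)).mul
      ((hf.measurable_apply r).comp hXi).inv).mul (hw.comp hXi)
  -- After Tonelli, independence factors the expectation for each fixed `q`, and each factor is at
  -- most `∫ w dq ≤ ρ`.
  rw [lintegral_lintegral_swap hjm.aemeasurable]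
  calc _ ≤ ∫⁻ q in A, ρ ^ n ∂prior := by
        refine setLIntegral_mono' hA fun q hq => ?_
        have hq' := hf.measurable_apply q
        have hr' := hf.measurable_apply r
        have hgm : Measurable fun x => f q x * (f r x)⁻¹ * w x := by fun_prop
        rw [lintegral_prod_eq_prod_lintegral_of_indepFun (Finset.range n)
          (fun i ω => f q (X i ω) * (f r (X i ω))⁻¹ * w (X i ω))
          (hindep.comp (fun _ x => f q x * (f r x)⁻¹ * w x) fun _ => hgm)
          fun i => hgm.comp (hXm i)]
        refine (Finset.prod_le_pow_card _ _ ρ fun i _ => ?_).trans_eq (by simp)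
        rw [← lintegral_map hgm (hXm i), (hX i).map_eq]
        exact (hf.lintegral_ratio_mul_le q r hw).trans (hρ q hq)
    _ ≤ ρ ^ n := by
        rw [setLIntegral_const]
        exact mul_le_of_le_one_right' prob_le_one

/-- The integrated likelihood ratio has expectation at most one. Finiteness keeps the posterior from
being `⊤ / ⊤`, which is `0` by convention. -/
theorem IsDensityVersion.ae_integratedLikelihood_ne_top [IsProbabilityMeasure P]
    [IsProbabilityMeasure prior] (hf : IsDensityVersion f)
    (hX : ∀ i, HasLaw (X i) r.toMeasure P) (hXm : ∀ i, Measurable (X i)) (hindep : iIndepFun X P) :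
    ∀ᵐ ω ∂P, ∀ n, ∫⁻ q, likelihood f (fun i => X i ω) n q ∂prior ≠ ⊤ := by
  have hfin : ∀ᵐ ω ∂P, ∀ n, invLikelihood f r (fun i => X i ω) n *
      ∫⁻ q, likelihood f (fun i => X i ω) n q ∂prior < ⊤ := by
    refine ae_all_iff.2 fun n => ae_lt_top ?_ ?_
    · exact (hf.measurable_invLikelihood hXm n).mul
        (hf.measurable_likelihood hXm n).lintegral_prod_left'
    · have := hf.lintegral_integratedLikelihood_le (prior := prior) hX hXm hindep
        MeasurableSet.univ (w := fun _ => 1) measurable_const (ρ := 1) (by simp) n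
      simp only [Finset.prod_const_one, one_mul, Measure.restrict_univ, one_pow] at this
      exact ne_top_of_le_ne_top ENNReal.one_ne_top this
  filter_upwards [hfin, hf.ae_invLikelihood hX] with ω h1 h2 n htop
  have := h1 n
  rw [htop, ENNReal.mul_top (h2 n).1] at this
  exact lt_irrefl _ this

/-! ### Exponential decay off weak neighbourhoods of `r` -/

/-- Half-spaces that do not contain `r` have exponentially small integrated likelihood ratios. -/
theorem IsDensityVersion.ae_tendsto_halfspace [IsProbabilityMeasure P]
    [IsProbabilityMeasure prior] (hf : IsDensityVersion f)
    (hX : ∀ i, HasLaw (X i) r.toMeasure P) (hXm : ∀ i, Measurable (X i)) (hindep : iIndepFun X P)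
    (g : ℝ →ᵇ ℝ) {η : ℝ} (hη : 0 < η) :
    ∃ c > 0, ∀ᵐ ω ∂P, Tendsto (fun n : ℕ => ENNReal.ofReal (Real.exp c) ^ n *
      (invLikelihood f r (fun i => X i ω) n *
        ∫⁻ q in {q | ∫ x, g x ∂q.toMeasure ≤ ∫ x, g x ∂r.toMeasure - η},
          likelihood f (fun i => X i ω) n q ∂prior)) atTop (𝓝 0) := by
  set m := ∫ x, g x ∂r.toMeasure with hm
  set A : Set DomProb := {q | ∫ x, g x ∂q.toMeasure ≤ m - η}
  have hA : MeasurableSet A := (isClosed_le (continuous_integral g) continuous_const).measurableSet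
  set M := ‖g‖ + |m - η / 2| + 1
  have hM : 0 < M := by positivity
  obtain ⟨t, ht, htM, htη⟩ : ∃ t > 0, t * M ≤ 1 ∧ t * M ^ 2 ≤ η / 4 := by
    refine ⟨min (1 / M) (η / 4 / M ^ 2), by positivity, ?_, ?_⟩
    · rw [← le_div_iff₀ hM]; exact min_le_left _ _
    · rw [← le_div_iff₀ (by positivity)]; exact min_le_right _ _
  -- Centring at the midpoint `m - η / 2` gives `h` mean `t * η / 2` under `r` and at most `-(t * η
  -- / 2)` under every `q ∈ A`.
  set h : ℝ → ℝ := fun x => t * (g x - (m - η / 2)) with hh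
  have hhm : Measurable h := by fun_prop
  have hhb : ∀ x, |h x| ≤ t * M := fun x => by
    rw [hh, abs_mul, abs_of_pos ht]
    have h1 := g.norm_coe_le_norm x
    rw [Real.norm_eq_abs] at h1
    have h2 := abs_sub (g x) (m - η / 2)
    gcongr
    linarith
  have hhi : ∀ q : DomProb, Integrable h q.toMeasure := fun q =>
    Integrable.of_bound hhm.aestronglyMeasurable _ (ae_of_all _ hhb)
  have hhint : ∀ q : DomProb, ∫ x, h x ∂q.toMeasure = t * (∫ x, g x ∂q.toMeasure - (m - η / 2)) := by
    intro q
    rw [hh, integral_const_mul, integral_sub (g.integrable _) (integrable_const _)]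
    simp
  -- The mean contributes `-(t * η / 2)` and the quadratic error at most `t * η / 4`; then `1 - y ≤
  -- exp (-y)`.
  have hρ : ∀ q ∈ A, ∫⁻ x, ENNReal.ofReal (Real.exp (h x)) ∂q.toMeasure
      ≤ ENNReal.ofReal (Real.exp (-(t * η / 4))) := by
    intro q hq
    rw [← ofReal_integral_eq_lintegral_ofReal (Integrable.of_bound hhm.exp.aestronglyMeasurable
      (Real.exp (t * M)) (ae_of_all _ fun x => by
        rw [Real.norm_of_nonneg (Real.exp_pos _).le]
        exact Real.exp_le_exp.2 ((le_abs_self _).trans (hhb x))))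
      (ae_of_all _ fun x => (Real.exp_pos _).le)]
    refine ENNReal.ofReal_le_ofReal ?_
    have e1 := integral_exp_le (μ := q.toMeasure) hhm htM hhb
    have e2 := Real.add_one_le_exp (-(t * η / 4))
    have e3 : ∫ x, g x ∂q.toMeasure ≤ m - η := hq
    have e4 : t * (∫ x, g x ∂q.toMeasure - (m - η / 2)) ≤ t * (-(η / 2)) := by
      gcongr
      linarith
    have e5 : t * (t * M ^ 2) ≤ t * (η / 4) := by gcongr
    rw [hhint] at e1
    linarith
  -- Half of the rate `t * η / 4` is claimed; the other half makes the expectations summable.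
  have hc : 0 < t * η / 8 := by positivity
  set s := ENNReal.ofReal (Real.exp (t * η / 8)) with hs
  refine ⟨t * η / 8, hc, ?_⟩
  have hwm : Measurable fun x => ENNReal.ofReal (Real.exp (h x)) := by fun_prop
  set F : ℕ → Ω → ℝ≥0∞ := fun n ω => s ^ n *
    ((∏ i ∈ Finset.range n, ENNReal.ofReal (Real.exp (h (X i ω)))) *
      (invLikelihood f r (fun i => X i ω) n *
        ∫⁻ q in A, likelihood f (fun i => X i ω) n q ∂prior)) with hF
  have hFm0 : ∀ n, Measurable fun ω =>
      (∏ i ∈ Finset.range n, ENNReal.ofReal (Real.exp (h (X i ω)))) *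
      (invLikelihood f r (fun i => X i ω) n *
        ∫⁻ q in A, likelihood f (fun i => X i ω) n q ∂prior) := fun n =>
    (Finset.measurable_prod _ fun i _ => hwm.comp (hXm i)).mul
      ((hf.measurable_invLikelihood hXm n).mul
        (hf.measurable_likelihood hXm n).lintegral_prod_left')
  have hFm : ∀ n, Measurable (F n) := fun n => (hFm0 n).const_mul _
  have hFle : ∀ n, ∫⁻ ω, F n ω ∂P ≤ ENNReal.ofReal (Real.exp (-(t * η / 8))) ^ n := fun n => by
    rw [hF, lintegral_const_mul _ (hFm0 n)]
    refine (mul_le_mul_right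
      (hf.lintegral_integratedLikelihood_le hX hXm hindep hA hwm hρ n) _).trans_eq ?_
    rw [← mul_pow, hs, ← ENNReal.ofReal_mul (Real.exp_pos _).le, ← Real.exp_add]
    congr 3
    ring
  have hsum : ∫⁻ ω, ∑' n, F n ω ∂P ≠ ⊤ := by
    rw [lintegral_tsum fun n => (hFm n).aemeasurable]
    refine ne_top_of_le_ne_top ?_ (ENNReal.tsum_le_tsum hFle)
    rw [ENNReal.tsum_geometric, ENNReal.inv_ne_top, Ne, tsub_eq_zero_iff_le, not_le]
    rw [ENNReal.ofReal_lt_one, Real.exp_lt_one_iff]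
    linarith
  have hmean : 0 < ∫ x, h x ∂r.toMeasure := by
    rw [hhint, ← hm]
    exact mul_pos ht (by linarith)
  filter_upwards [ae_lt_top (Measurable.tsum hFm) hsum,
    ae_tendsto_average hX hindep hhm (hhi r)] with ω h1 h2
  have h3 := ENNReal.tendsto_atTop_zero_of_tsum_ne_top h1.ne
  refine tendsto_of_tendsto_of_tendsto_of_le_of_le' tendsto_const_nhds h3
    (Eventually.of_forall fun _ => zero_le) ?_
  -- Under `r` the sum of the `h (X i)` tends to infinity, so the weight is eventually at least one
  -- and can be dropped.
  filter_upwards [(tendsto_sum_atTop_of_average hmean h2).eventually_ge_atTop 0] with n hn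
  refine mul_le_mul_right (le_mul_of_one_le_left zero_le ?_) (s ^ n)
  rw [ENNReal.prod_ofReal_exp (fun i => h (X i ω)), ENNReal.one_le_ofReal]
  exact Real.one_le_exp hn

/-- The integrated likelihood ratio is exponentially small off every weak neighbourhood of `r`. -/
theorem IsDensityVersion.ae_tendsto_compl [IsProbabilityMeasure P]
    [IsProbabilityMeasure prior] (hf : IsDensityVersion f)
    (hX : ∀ i, HasLaw (X i) r.toMeasure P) (hXm : ∀ i, Measurable (X i)) (hindep : iIndepFun X P)
    {V : Set DomProb} (hV : V ∈ 𝓝 r) :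
    ∃ c > 0, ∀ᵐ ω ∂P, Tendsto (fun n : ℕ => ENNReal.ofReal (Real.exp c) ^ n *
      (invLikelihood f r (fun i => X i ω) n *
        ∫⁻ q in Vᶜ, likelihood f (fun i => X i ω) n q ∂prior)) atTop (𝓝 0) := by
  -- The sets with exponentially negligible complement form a filter, the rate of an intersection
  -- being the smaller one. Hence it is enough to treat half-spaces.
  let F : Filter DomProb :=
    { sets := {V | ∃ c > 0, ∀ᵐ ω ∂P, Tendsto (fun n : ℕ => ENNReal.ofReal (Real.exp c) ^ n *
        (invLikelihood f r (fun i => X i ω) n *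
          ∫⁻ q in Vᶜ, likelihood f (fun i => X i ω) n q ∂prior)) atTop (𝓝 0)}
      univ_sets := ⟨1, one_pos, by simp⟩
      sets_of_superset := by
        rintro V W ⟨c, hc, h⟩ hVW
        refine ⟨c, hc, h.mono fun ω hω => tendsto_of_tendsto_of_tendsto_of_le_of_le
          tendsto_const_nhds hω (fun _ => zero_le) fun n => ?_⟩
        dsimp only
        gcongr
      inter_sets := by
        rintro V W ⟨c, hc, h⟩ ⟨c', hc', h'⟩
        refine ⟨min c c', lt_min hc hc', ?_⟩
        filter_upwards [h, h'] with ω hω hω'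
        have hadd := hω.add hω'
        rw [add_zero] at hadd
        refine tendsto_of_tendsto_of_tendsto_of_le_of_le tendsto_const_nhds hadd
          (fun _ => zero_le) fun n => ?_
        dsimp only
        rw [Set.compl_inter]
        refine (mul_le_mul_right (mul_le_mul_right (lintegral_union_le _ _ _) _) _).trans ?_
        rw [mul_add, mul_add]
        gcongr
        · exact min_le_left _ _
        · exact min_le_right _ _ }
  have hF : F ≤ 𝓝 r := nhds_le_of_forall_lt fun g η hη => by
    obtain ⟨c, hc, h⟩ := hf.ae_tendsto_halfspace (prior := prior) hX hXm hindep g hη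
    refine ⟨c, hc, ?_⟩
    have e : {q : DomProb | ∫ x, g x ∂r.toMeasure - η < ∫ x, g x ∂q.toMeasure}ᶜ
        = {q | ∫ x, g x ∂q.toMeasure ≤ ∫ x, g x ∂r.toMeasure - η} := by
      ext q
      simp
    simpa only [e] using h
  exact hF hV

/-! ### Subexponential lower bound near `r` -/

/-- The integrated likelihood ratio over a set that contains some `B_δ(r, r)` is not exponentially
small. -/
theorem IsDensityVersion.ae_tendsto_top [IsProbabilityMeasure P]
    [IsProbabilityMeasure prior] (hf : IsDensityVersion f)
    (hX : ∀ i, HasLaw (X i) r.toMeasure P) (hXm : ∀ i, Measurable (X i)) (hindep : iIndepFun X P)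
    (hr : Ldiv r r ≠ ⊤) (hr' : Ldiv r r ≠ ⊥) {c δ : ℝ} (hδ : δ ≤ c)
    (hprior : 0 < prior (LBall δ r r)) {Φ : Set DomProb} (hΦ : LBall δ r r ⊆ Φ) :
    ∀ᵐ ω ∂P, Tendsto (fun n : ℕ => ENNReal.ofReal (Real.exp c) ^ n *
      (invLikelihood f r (fun i => X i ω) n *
        ∫⁻ q in Φ, likelihood f (fun i => X i ω) n q ∂prior)) atTop (𝓝 ⊤) := by
  have hB : MeasurableSet (LBall δ r r) :=
    measurableSet_lt (hf.measurable_Ldiv r) measurable_const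
  set G : ℕ → DomProb × Ω → ℝ≥0∞ := fun n z => ENNReal.ofReal (Real.exp c) ^ n *
      (invLikelihood f r (fun i => X i z.2) n * likelihood f (fun i => X i z.2) n z.1) with hG
  have hGm : ∀ n, Measurable (G n) := fun n =>
    (((hf.measurable_invLikelihood hXm n).comp measurable_snd).mul
      (hf.measurable_likelihood hXm n)).const_mul _
  obtain ⟨-, r2, r3⟩ := hf.Ldiv_finite hr hr'
  have hpt : ∀ q ∈ LBall δ r r, ∀ᵐ ω ∂P, Tendsto (fun n => G n (q, ω)) atTop (𝓝 ⊤) := by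
    intro q hq
    have hlt : Ldiv q r < Ldiv r r + δ := hq
    have hqt : Ldiv q r ≠ ⊤ := (hlt.trans_le le_top).ne
    obtain ⟨q1, q2, q3⟩ := hf.Ldiv_finite hqt (hf.Ldiv_ne_bot hr hr' hqt)
    rw [q3, r3, ← EReal.coe_add, EReal.coe_lt_coe_iff] at hlt
    -- Its `r`-mean is `c - (L(q ‖ r) - L(r ‖ r)) > c - δ ≥ 0`, so by the strong law the scaled
    -- likelihood ratio, the exponential of a sum of values of `ℓ`, diverges.
    set ℓ : ℝ → ℝ := fun x => c + (Real.log (f q x).toReal - Real.log (f r x).toReal) with hℓ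
    have hℓi : Integrable ℓ r.toMeasure := (integrable_const c).add (q2.sub r2)
    have hℓm : Measurable ℓ := by
      have h1 := hf.measurable_apply q
      have h2 := hf.measurable_apply r
      exact ((Real.measurable_log.comp h1.ennreal_toReal).sub
        (Real.measurable_log.comp h2.ennreal_toReal)).const_add c
    have hℓpos : 0 < ∫ x, ℓ x ∂r.toMeasure := by
      have e1 := integral_add (integrable_const (μ := r.toMeasure) c) (q2.sub r2)
      have e2 := integral_sub q2 r2
      simp only [Pi.sub_apply] at e1
      rw [hℓ, e1, e2]
      simp only [integral_const, probReal_univ, smul_eq_mul, one_mul]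
      linarith
    have hfin : ∀ᵐ ω ∂P, ∀ i, (f r (X i ω) ≠ 0 ∧ f r (X i ω) ≠ ⊤) ∧
        (f q (X i ω) ≠ 0 ∧ f q (X i ω) ≠ ⊤) := by
      refine ae_all_iff.2 fun i => ?_
      have := (hf.ae_pos_finite r).and q1
      rw [← (hX i).map_eq] at this
      exact ae_of_ae_map (hX i).aemeasurable this
    filter_upwards [hfin, ae_tendsto_average hX hindep hℓm hℓi] with ω h1 h2
    have h3 := ENNReal.tendsto_ofReal_atTop.comp
      (Real.tendsto_exp_atTop.comp (tendsto_sum_atTop_of_average hℓpos h2))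
    refine h3.congr fun n => ?_
    simp only [Function.comp_apply]
    rw [← ENNReal.prod_ofReal_exp (fun i => ℓ (X i ω))]
    change _ = ENNReal.ofReal (Real.exp c) ^ n *
      (invLikelihood f r (fun i => X i ω) n * likelihood f (fun i => X i ω) n q)
    rw [invLikelihood, likelihood, ← Finset.prod_mul_distrib, show ENNReal.ofReal (Real.exp c) ^ n = ∏ _i ∈ Finset.range n, ENNReal.ofReal (Real.exp c) by
      simp, ← Finset.prod_mul_distrib]
    refine Finset.prod_congr rfl fun i _ => ?_
    obtain ⟨⟨a1, a2⟩, b1, b2⟩ := h1 i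
    have hu := ENNReal.toReal_pos b1 b2
    have hv := ENNReal.toReal_pos a1 a2
    rw [hℓ]
    simp only
    rw [Real.exp_add, Real.exp_sub, Real.exp_log hu, Real.exp_log hv,
      ENNReal.ofReal_mul (Real.exp_pos _).le, ENNReal.ofReal_div_of_pos hv,
      ENNReal.ofReal_toReal a2, ENNReal.ofReal_toReal b2, ENNReal.div_eq_inv_mul]
  have hset : MeasurableSet {z : DomProb × Ω | Tendsto (fun n => G n (z.1, z.2)) atTop (𝓝 ⊤)} :=
    measurableSet_tendsto (𝓝 ⊤) hGm
  have hae : ∀ᵐ q ∂(prior.restrict (LBall δ r r)), ∀ᵐ ω ∂P,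
      Tendsto (fun n => G n (q, ω)) atTop (𝓝 ⊤) :=
    (ae_restrict_mem hB).mono hpt
  -- The null set of `ω` depends on `q`; Fubini gives one null set of `ω` off which divergence holds
  -- for almost every `q`, as Fatou's lemma requires.
  rw [Measure.ae_ae_comm hset] at hae
  filter_upwards [hae] with ω hω
  have hGq : ∀ n, Measurable fun q => G n (q, ω) := fun n =>
    (hGm n).comp (measurable_id.prodMk measurable_const)
  have hfatou := lintegral_liminf_le (μ := prior.restrict (LBall δ r r)) (u := atTop) hGq
  have htop : ∫⁻ q in LBall δ r r, liminf (fun n => G n (q, ω)) atTop ∂prior = ⊤ := by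
    rw [lintegral_congr_ae (g := fun _ => ⊤) (hω.mono fun q hq => hq.liminf_eq), setLIntegral_const,
      ENNReal.top_mul hprior.ne']
  rw [htop, top_le_iff] at hfatou
  have hBt : Tendsto (fun n => ∫⁻ q in LBall δ r r, G n (q, ω) ∂prior) atTop (𝓝 ⊤) :=
    tendsto_of_le_liminf_of_limsup_le hfatou.ge le_top
  refine tendsto_of_tendsto_of_tendsto_of_le_of_le hBt tendsto_const_nhds (fun n => ?_)
    fun _ => le_top
  have hlm : Measurable fun q => likelihood f (fun i => X i ω) n q :=
    (hf.measurable_likelihood hXm n).comp (measurable_id.prodMk measurable_const)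
  have hGint : ∫⁻ q in LBall δ r r, G n (q, ω) ∂prior = ENNReal.ofReal (Real.exp c) ^ n *
      (invLikelihood f r (fun i => X i ω) n *
        ∫⁻ q in LBall δ r r, likelihood f (fun i => X i ω) n q ∂prior) := by
    rw [← lintegral_const_mul _ hlm, ← lintegral_const_mul _ (hlm.const_mul _)]
  rw [hGint]
  gcongr

/-! ### Posterior consistency and the theorem -/

/-- Schwartz's theorem: the posterior is weakly consistent at `r`. -/
theorem IsDensityVersion.ae_tendsto_posterior [IsProbabilityMeasure P]
    [IsProbabilityMeasure prior] (hf : IsDensityVersion f)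
    (hX : ∀ i, HasLaw (X i) r.toMeasure P) (hindep : iIndepFun X P)
    (hr : Ldiv r r ≠ ⊤) (hr' : Ldiv r r ≠ ⊥)
    (hprior : ∀ δ : ℝ, 0 < δ → 0 < prior (LBall δ r r))
    {Φ U : Set DomProb} (hΦ : Φ ∈ 𝓝 r) (hU : U ∈ 𝓝 r) :
    ∀ᵐ ω ∂P, Tendsto (fun n => posterior prior Φ f (fun i => X i ω) n U) atTop (𝓝 1) := by
  -- `HasLaw` gives only a.e. measurability; countably many modifications change nothing almost
  -- surely.
  wlog hXm : ∀ i, Measurable (X i) generalizing X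
  · have hae : ∀ i, X i =ᵐ[P] (hX i).aemeasurable.mk (X i) := fun i => (hX i).aemeasurable.ae_eq_mk
    have h := this (X := fun i => (hX i).aemeasurable.mk (X i)) (fun i => (hX i).congr (hae i).symm)
      (hindep.congr hae) fun i => (hX i).aemeasurable.measurable_mk
    filter_upwards [h, ae_all_iff.2 hae] with ω h1 h2
    simpa only [h2] using h1
  obtain ⟨c, hc, hcompl⟩ := hf.ae_tendsto_compl (prior := prior) hX hXm hindep hU
  obtain ⟨δ₀, hδ₀, hsub⟩ := hf.exists_LBall_subset hr hr' hΦ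
  -- The radius `min c δ₀` keeps the ball inside `Φ` and the loss within the decay rate `c` of the
  -- numerator.
  have hden := hf.ae_tendsto_top hX hXm hindep hr hr' (min_le_left c δ₀)
    (hprior _ (lt_min hc hδ₀)) (hsub _ (min_le_right _ _))
  filter_upwards [hcompl, hden, hf.ae_invLikelihood hX,
    hf.ae_integratedLikelihood_ne_top (prior := prior) hX hXm hindep] with ω h1 h2 h3 h4
  -- The scaling and the likelihood of `r` cancel in this quotient, and the posterior of `U` is at
  -- least one minus it.
  have hratio := ENNReal.Tendsto.div h1 (Or.inr ENNReal.top_ne_zero) h2 (Or.inr ENNReal.zero_ne_top)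
  rw [ENNReal.zero_div] at hratio
  have hsubt := ENNReal.Tendsto.sub (tendsto_const_nhds (x := (1 : ℝ≥0∞))) hratio
    (Or.inl ENNReal.one_ne_top)
  rw [tsub_zero] at hsubt
  refine tendsto_of_tendsto_of_tendsto_of_le_of_le' hsubt tendsto_const_nhds ?_
    (Eventually.of_forall fun n => ENNReal.div_le_of_le_mul ?_)
  · filter_upwards [h2.eventually_ne ENNReal.top_ne_zero] with n hn
    have hs0 : ENNReal.ofReal (Real.exp c) ^ n ≠ 0 :=
      pow_ne_zero _ (ENNReal.ofReal_pos.2 (Real.exp_pos c)).ne'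
    have hst : ENNReal.ofReal (Real.exp c) ^ n ≠ ⊤ := ENNReal.pow_ne_top ENNReal.ofReal_ne_top
    have hD0 : ∫⁻ q in Φ, likelihood f (fun i => X i ω) n q ∂prior ≠ 0 := by
      intro h0
      simp [h0] at hn
    have hDt : ∫⁻ q in Φ, likelihood f (fun i => X i ω) n q ∂prior ≠ ⊤ :=
      ne_top_of_le_ne_top (h4 n) (setLIntegral_le_lintegral _ _)
    rw [ENNReal.mul_div_mul_left _ _ hs0 hst, ENNReal.mul_div_mul_left _ _ (h3 n).1 (h3 n).2,
      tsub_le_iff_right, posterior, ENNReal.div_add_div_same, ENNReal.le_div_iff_mul_le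
        (Or.inl hD0) (Or.inl hDt), one_mul]
    refine le_trans (lintegral_mono_set ?_) (lintegral_union_le _ _ _)
    intro q hq
    by_cases hqU : q ∈ U
    · exact Or.inl ⟨hqU, hq⟩
    · exact Or.inr hqU
  · rw [one_mul]
    exact lintegral_mono_set Set.inter_subset_right

end DomProb

theorem theorem2p2
    {Ω : Type*} [MeasurableSpace Ω] (P : Measure Ω) [IsProbabilityMeasure P]
    -- the observations are i.i.d. with law `r`
    (r : DomProb) (X : ℕ → Ω → ℝ)
    (hX : ∀ i, HasLaw (X i) r.toMeasure P) (hindep : iIndepFun X P)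
    -- the prior, and any jointly measurable version of the densities
    (prior : Measure DomProb) [IsProbabilityMeasure prior]
    (f : DomProb → ℝ → ℝ≥0∞) (hf : DomProb.IsDensityVersion f)
    -- the model
    (Φ : Set DomProb) (hΦ : IsOpen Φ)
    -- the Schwartz conditions
    (hprior : ∀ q ∈ Φ, ∀ δ : ℝ, 0 < δ → 0 < prior (DomProb.LBall δ q r))
    (hL_top : DomProb.LdivSet Φ r < ⊤) (hL_bot : ⊥ < DomProb.LdivSet Φ r)
    -- weak balls centered at finitely many (at least one) L-projections of `r` on `Φ`
    (d : MetricSpace DomProb) (hd : DomProb.MetrizesWeak d)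
    (ε : ℝ) (hε : 0 < ε)
    (κ : ℕ) (hκ : 0 < κ) (qhat : Fin κ → DomProb) (hqhat : ∀ k, DomProb.IsLProjection (qhat k) Φ r) :
    ∀ᵐ ω ∂P, Tendsto
      (fun n : ℕ => DomProb.posterior prior Φ f (fun i => X i ω) n (⋃ k, DomProb.weakBall d (qhat k) ε))
      atTop (𝓝 1) := by
  have hproj := hqhat ⟨0, hκ⟩
  have hL : DomProb.LdivSet Φ r = DomProb.Ldiv (qhat ⟨0, hκ⟩) r :=
    le_antisymm (iInf₂_le _ hproj.1) (le_iInf₂ hproj.2)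
  rw [hL] at hL_top hL_bot
  -- The projection is `r` itself, so `r ∈ Φ`, the prior condition holds at `r`, and one ball of the
  -- union is centred at `r`.
  have hqr := hproj.eq_of_isOpen hf hΦ hL_top.ne hL_bot.ne'
  rw [hqr] at hL_top hL_bot hproj
  have hU : DomProb.weakBall d r ε ∈ 𝓝 r := by
    have hopen := @Metric.isOpen_ball _ d.toPseudoMetricSpace r ε
    rw [show d.toPseudoMetricSpace.toUniformSpace.toTopologicalSpace = DomProb.weakTopology from hd]
      at hopen
    exact hopen.mem_nhds (@Metric.mem_ball_self _ d.toPseudoMetricSpace r ε hε)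
  refine hf.ae_tendsto_posterior hX hindep hL_top.ne hL_bot.ne' (hprior r hproj.1)
    (hΦ.mem_nhds hproj.1) (mem_of_superset hU ?_)
  rw [← hqr]
  exact Set.subset_iUnion (fun k => DomProb.weakBall d (qhat k) ε) ⟨0, hκ⟩
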